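/- Let $M\ge 1$, $\beta\ge 0$, $\lambda,h\in\mathbb R$, with $\beta\le 1$ or $h\neq 0$. For $N\ge1$ consider the following random variables with values in $\{-1,1\}^N$. The signal $\boldsymbol{\hat\xi}$ is uniform on $\{-1,1\}^N$. Given $\boldsymbol{\hat\xi}$, the examples $\boldsymbol s^1,\dots,\boldsymbol s^M$ are independent, each with law proportional to $$\exp\Big(\frac{\beta}{N}\sum_{i<j}\hat\xi_i\hat\xi_js_is_j+h\sum_i\hat\xi_is_i\Big).$$ Given $\boldsymbol{\hat\xi}$ and $\mathcal S=(\boldsymbol s^\mu)_\mu$, the student pattern $\boldsymbol\xi$ has law proportional to $$\exp\Big(\frac{\beta}{N}\sum_{\mu=1}^M\sum_{i<j}s^\mu_is^\mu_j\xi_i\xi_j+\lambda\sum_i\hat\xi_i\xi_i\Big).$$ Write $\langle\cdot\rangle_{\lambda,h}$ for the expectation over the joint law of $(\boldsymbol{\hat\xi},\mathcal S,\boldsymbol\xi)$, and also for the gauge-fixed expectation, in which $\boldsymbol{\hat\xi}$ is replaced by $\boldsymbol 1=(1,\dots,1)$ (so that the examples are independent Curie–Weiss configurations in the uniform field $h$,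 and $\boldsymbol\xi$ is a Hopfield model with these patterns in the uniform field $\lambda$). Let $Q_N(\boldsymbol x,\boldsymbol y)=\frac1N\sum_i x_iy_i$. Let $$m_0(\beta,h)=\operatorname*{argmax}_{x\in\mathbb R}\Big[\log 2+\log\cosh(\beta x+h)-\frac{\beta x^2}{2}\Big],$$ let $\boldsymbol s\in\{-1,1\}^M$ have i.i.d. entries of mean $m_0(\beta,h)$, write $\langle\cdot\rangle_{\boldsymbol s}$ for the expectation over $\boldsymbol s$, and for $\boldsymbol p\in\mathbb R^M$ put $$g(\boldsymbol p;\beta,\lambda,h)=\log 2-\frac{\beta\,\boldsymbol p^2}{2}+\big\langle\log\cosh(\beta\,\boldsymbol s\cdot\boldsymbol p+\lambda)\big\rangle_{\boldsymbol s}.$$ Suppose that $\boldsymbol p\in\mathbb R^M$ is the unique maximizer of $g(\cdot\,;\beta,\lambda,h)$. Then the maximizer $m_0(\beta,h)$ exists and is unique, and, for both expectations, 1. $\lim_{N\to\infty}\langle Q_N(\boldsymbol s^\mu,\boldsymbol{\hat\xi})\rangle_{\lambda,h}=m_0(\beta,h)$ for all $\mu=1,\dots,M$; in the gauge-fixed case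 this overlap is $\frac{\boldsymbol s^\mu\cdot\boldsymbol 1}{N}$; 2. $\lim_{N\to\infty}\langle Q_N(\boldsymbol s^\mu,\boldsymbol\xi)\rangle_{\lambda,h}=p^\mu$ for all $\mu=1,\dots,M$; 3. $\lim_{N\to\infty}\langle Q_N(\boldsymbol{\hat\xi},\boldsymbol\xi)\rangle_{\lambda,h}=\langle\tanh(\beta\,\boldsymbol s\cdot\boldsymbol p+\lambda)\rangle_{\boldsymbol s}$; in the gauge-fixed case this overlap is $\frac{\boldsymbol 1\cdot\boldsymbol\xi}{N}$. Moreover the random variables $Q_N(\boldsymbol s^\mu,\boldsymbol{\hat\xi})$, $Q_N(\boldsymbol s^\mu,\boldsymbol\xi)$ and $Q_N(\boldsymbol{\hat\xi},\boldsymbol\xi)$ are self-averaging: as $N\to\infty$ they converge in probability to the respective deterministic limits above. -/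

import Mathlib

open Filter Topology

namespace TeacherStudent

/-- Spin configurations: elements of `{-1, 1}^N`. -/
abbrev Spins (N : ℕ) : Type := Fin N → ℤˣ

/-- A spin configuration seen as a vector of `ℝ^N`. -/
def vec {N : ℕ} (x : Spins N) : Fin N → ℝ := fun i => ((x i : ℤ) : ℝ)

/-- The overlap `Q_N(x, y) = (x · y) / N`. -/
noncomputable def overlap {N : ℕ} (x y : Fin N → ℝ) : ℝ := (∑ i, x i * y i) / N

/-- The pair interaction `∑_{i<j} x_i x_j y_i y_j`. -/
noncomputable def pairSum {N : ℕ} (x y : Fin N → ℝ) : ℝ :=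
  ∑ i, ∑ j ∈ Finset.Ioi i, x i * x j * y i * y j

/-- Boltzmann weight of one example `s` given the signal `σ`:
`exp ((β/N) ∑_{i<j} σ_i σ_j s_i s_j + h ∑_i σ_i s_i)`.
For `σ = 1` this is the Curie-Weiss weight at inverse temperature `β` in the field `h`. -/
noncomputable def exampleWeight {N : ℕ} (β h : ℝ) (σ s : Spins N) : ℝ :=
  Real.exp (β / N * pairSum (vec σ) (vec s) + h * ∑ i, vec σ i * vec s i)

/-- `P(S | σ)`: given the signal `σ`, the `M` examples are independent. -/
noncomputable def examplesLaw {N M : ℕ} (β h : ℝ) (σ : Spins N) (S : Fin M → Spins N) : ℝ :=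
  ∏ μ, exampleWeight β h σ (S μ) / ∑ s : Spins N, exampleWeight β h σ s

/-- Boltzmann weight of the student pattern `ξ` given the examples `S`:
`exp ((β/N) ∑_μ ∑_{i<j} s_i^μ s_j^μ ξ_i ξ_j + lam ∑_i σ_i ξ_i)`.
For `σ = 1` this is the Hopfield weight with patterns `S` in the uniform field `lam`;
for `lam = 0` it does not depend on `σ`. -/
noncomputable def studentWeight {N M : ℕ} (β lam : ℝ) (σ : Spins N) (S : Fin M → Spins N)
    (ξ : Spins N) : ℝ :=
  Real.exp (β / N * ∑ μ, pairSum (vec (S μ)) (vec ξ) + lam * ∑ i, vec σ i * vec ξ i)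

/-- The Boltzmann-Gibbs distribution of the student pattern. -/
noncomputable def studentLaw {N M : ℕ} (β lam : ℝ) (σ : Spins N) (S : Fin M → Spins N)
    (ξ : Spins N) : ℝ :=
  studentWeight β lam σ S ξ / ∑ η : Spins N, studentWeight β lam σ S η

/-- A realization of the model: the signal, the `M` examples and the student pattern. -/
structure Config (N M : ℕ) where
  signal : Spins N
  ex : Fin M → Spins N
  student : Spins N

/-- The expectation given the signal `σ`. -/
noncomputable def bracketGiven {N M : ℕ} (β lam h : ℝ) (σ : Spins N)
    (f : Config N M → ℝ) : ℝ :=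
  ∑ S : Fin M → Spins N, ∑ ξ : Spins N,
    f ⟨σ, S, ξ⟩ * studentLaw β lam σ S ξ * examplesLaw β h σ S

/-- The expectation over the joint distribution of signal, examples and student pattern;
the signal is a Rademacher vector. -/
noncomputable def bracket {N M : ℕ} (β lam h : ℝ) (f : Config N M → ℝ) : ℝ :=
  ∑ σ : Spins N, (1 / 2 ^ N) * bracketGiven β lam h σ f

/-- The gauge-fixed expectation: the signal is `(1, …, 1)`, the examples are `M` independent
samples of the Curie-Weiss model, the student is the Hopfield model with these patterns. -/
noncomputable def gaugedBracket {N M : ℕ} (β lam h : ℝ) (f : Config N M → ℝ) : ℝ :=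
  bracketGiven β lam h 1 f

/-- Self-averaging around `c`, for a family of expectations `E N`: the variables `X N` converge
in probability to the constant `c`. -/
def SelfAveragingAt {M : ℕ} (E : ∀ N : ℕ, (Config N M → ℝ) → ℝ)
    (X : ∀ N : ℕ, Config N M → ℝ) (c : ℝ) : Prop :=
  ∀ δ : ℝ, 0 < δ →
    Tendsto (fun N => E N (Set.indicator {ω | δ < |X N ω - c|} (fun _ => 1))) atTop (𝓝 0)

/-- The Curie-Weiss variational function `log 2 + log cosh (β x + h) - β x² / 2`. -/
noncomputable def cwFun (β h x : ℝ) : ℝ :=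
  Real.log 2 + Real.log (Real.cosh (β * x + h)) - β * x ^ 2 / 2

/-- `m₀(β, h)`, the maximizer of the Curie-Weiss variational function. -/
noncomputable def m0 (β h : ℝ) : ℝ :=
  Classical.epsilon fun x => ∀ y, cwFun β h y ≤ cwFun β h x

/-- The expectation of `F(s)` for `s ∈ {-1, 1}^M` with i.i.d. entries of mean `m`. -/
noncomputable def iidAvg {M : ℕ} (m : ℝ) (F : (Fin M → ℝ) → ℝ) : ℝ :=
  ∑ s : Spins M, F (vec s) * ∏ μ, (1 + m * vec s μ) / 2

/-- `g(p; β, λ, h) = log 2 - β p² / 2 + ⟨log cosh (β s·p + λ)⟩_s`. -/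
noncomputable def g {M : ℕ} (β lam h : ℝ) (p : Fin M → ℝ) : ℝ :=
  Real.log 2 - β * (∑ μ, p μ ^ 2) / 2 +
    iidAvg (m0 β h) fun s => Real.log (Real.cosh (β * (∑ μ, s μ * p μ) + lam))

/-- The overlap of the example `μ` with the signal. -/
noncomputable def exampleSignal {M : ℕ} (μ : Fin M) (N : ℕ) (ω : Config N M) : ℝ :=
  overlap (vec (ω.ex μ)) (vec ω.signal)

/-- The overlap of the example `μ` with the student pattern. -/
noncomputable def exampleStudent {M : ℕ} (μ : Fin M) (N : ℕ) (ω : Config N M) : ℝ :=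
  overlap (vec (ω.ex μ)) (vec ω.student)

/-- The overlap of the signal with the student pattern. -/
noncomputable def signalStudent {M : ℕ} (N : ℕ) (ω : Config N M) : ℝ :=
  overlap (vec ω.signal) (vec ω.student)

end TeacherStudent

open TeacherStudent

/-! Multiplying all configurations sitewise by the signal preserves the laws and the overlaps, so
the two expectations agree on overlaps and the signal may be taken to be `1`
(`bracket_eq_gaugedBracket`). Two stacked mean-field systems remain: the examples, with energy
quadratic in their overlaps with `1`, and, given them, the student, with energy quadratic in its
overlaps with the examples.

One principle handles both. Since |q|² = 2 q·r - |r|² + |q - r|², the quadratic energy lies above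
its tangent at every r and close to it near r, and the partition functions of the tangents factorize
over sites. The tangent at p bounds the partition function from below; the tangent at r bounds the
weight of q ≈ r from above (`gibbsMass_energy_le`). Covering the overlaps away from a unique
maximizer by finitely many balls gives exponential concentration of q; an extra tilt t u,
differentiated at t = 0, gives concentration of u.

For the examples the tangent pressure is exactly a sum of Curie-Weiss functions, maximal only at
`m0`. Tilting by column frequencies shows that each column a in {-1, 1}^M appears with its product
frequency (`columnFreq_concentrates`). The student's tangent pressure depends on the examples only
through these frequencies (`pressure_student`), so with high probability it is close to `g`: the
maximizer p gives the example-student overlap, and the derivative in `lam` gives the tanh average.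
-/

namespace MeanField

/-! ### Concentration for Gibbs measures with quadratic energy -/

/-- The probability of `A` under the Gibbs measure with weight `exp H`. -/
noncomputable def gibbsMass {Ω : Type} [Fintype Ω] (H : Ω → ℝ) (A : Set Ω) : ℝ :=
  ∑ x, A.indicator (fun _ => (1 : ℝ)) x * (Real.exp (H x) / ∑ y, Real.exp (H y))

/-- The Hamiltonian `K (β |q|² / 2 + f)`. -/
noncomputable def energy {ι Ω : Type} [Fintype ι] (K β : ℝ) (q : Ω → ι → ℝ) (f : Ω → ℝ)
    (x : Ω) : ℝ :=
  K * (β / 2 * ∑ k, q x k ^ 2 + f x)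

/-- The pressure of the Hamiltonian linearized at `r` and tilted by `t u`. -/
noncomputable def pressure {ι Ω : Type} [Fintype ι] [Fintype Ω] (K β : ℝ) (q : Ω → ι → ℝ)
    (f u : Ω → ℝ) (r : ι → ℝ) (t : ℝ) : ℝ :=
  Real.log (∑ x, Real.exp (K * (β * ∑ k, q x k * r k + f x + t * u x))) / K
    - β / 2 * ∑ k, r k ^ 2

section

variable {ι Ω : Type} [Fintype ι] [Fintype Ω]

theorem gibbsMass_le_sum {J : Type*} (H : Ω → ℝ) (A : Set Ω) (F : Finset J) (B : J → Set Ω)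
    (h : ∀ x ∈ A, ∃ j ∈ F, x ∈ B j) : gibbsMass H A ≤ ∑ j ∈ F, gibbsMass H (B j) := by
  unfold gibbsMass
  rw [Finset.sum_comm]
  refine Finset.sum_le_sum fun x _ => ?_
  rw [← Finset.sum_mul]
  refine mul_le_mul_of_nonneg_right ?_
    (div_nonneg (Real.exp_pos _).le (Finset.sum_nonneg fun _ _ => (Real.exp_pos _).le))
  by_cases hx : x ∈ A
  · obtain ⟨j, hj, hxj⟩ := h x hx
    rw [Set.indicator_of_mem hx]
    calc (1 : ℝ) = (B j).indicator (fun _ => (1 : ℝ)) x := by rw [Set.indicator_of_mem hxj]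
      _ ≤ _ := Finset.single_le_sum (f := fun j => (B j).indicator (fun _ => (1 : ℝ)) x)
        (fun i _ => Set.indicator_nonneg (fun _ _ => zero_le_one) x) hj
  · rw [Set.indicator_of_notMem hx]
    exact Finset.sum_nonneg fun i _ => Set.indicator_nonneg (fun _ _ => zero_le_one) x

theorem gibbsMass_le_add (H : Ω → ℝ) (A B C D : Set Ω) (h : A ⊆ B ∪ C ∪ D) :
    gibbsMass H A ≤ gibbsMass H B + gibbsMass H C + gibbsMass H D := by
  have := gibbsMass_le_sum H A Finset.univ ![B, C, D] (fun x hx => by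
    rcases h hx with (h | h) | h
    exacts [⟨0, by simp, h⟩, ⟨1, by simp, h⟩, ⟨2, by simp, h⟩])
  simpa [Fin.sum_univ_three] using this

theorem exp_pressure [Nonempty Ω] {K : ℝ} (hK : 0 < K) (β : ℝ) (q : Ω → ι → ℝ) (f u : Ω → ℝ)
    (r : ι → ℝ) (t : ℝ) :
    Real.exp (K * pressure K β q f u r t) =
      ∑ x, Real.exp (K * (β * ∑ k, q x k * r k + f x + t * u x - β / 2 * ∑ k, r k ^ 2)) := by
  have hpos : 0 < ∑ x, Real.exp (K * (β * ∑ k, q x k * r k + f x + t * u x)) :=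
    Finset.sum_pos (fun _ _ => Real.exp_pos _) Finset.univ_nonempty
  rw [pressure, mul_sub, mul_div_cancel₀ _ hK.ne', Real.exp_sub, Real.exp_log hpos,
    Finset.sum_div]
  refine Finset.sum_congr rfl fun x _ => ?_
  rw [← Real.exp_sub]
  congr 1
  ring

/-- Dropping |q - p|² ≥ 0 bounds the partition function below by the tangent at p. On `A` the
discarded square |q - r|² is at most card ι · ε², and exp (K (t u - a)) ≥ 1 is inserted as in the
exponential Chebyshev inequality. -/
theorem gibbsMass_energy_le [Nonempty Ω] {K β : ℝ} (hK : 0 < K) (hβ : 0 ≤ β) (q : Ω → ι → ℝ)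
    (f u : Ω → ℝ) (p r : ι → ℝ) {ε t a : ℝ} (A : Set Ω)
    (hq : ∀ x ∈ A, ∀ k, |q x k - r k| ≤ ε) (hu : ∀ x ∈ A, a ≤ t * u x) :
    gibbsMass (energy K β q f) A ≤ Real.exp (K * (pressure K β q f u r t
      - pressure K β q f u p 0 + β / 2 * (Fintype.card ι * ε ^ 2) - a)) := by
  have hZ : Real.exp (K * pressure K β q f u p 0) ≤ ∑ y, Real.exp (energy K β q f y) := by
    rw [exp_pressure hK]
    refine Finset.sum_le_sum fun x _ => Real.exp_le_exp.2 (mul_le_mul_of_nonneg_left ?_ hK.le)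
    have : 0 ≤ β / 2 * ∑ k, (q x k - p k) ^ 2 := by positivity
    simp only [sub_sq, Finset.sum_add_distrib, Finset.sum_sub_distrib, mul_assoc,
      ← Finset.mul_sum] at this
    linarith
  have hN : ∑ x, A.indicator (fun _ => (1 : ℝ)) x * Real.exp (energy K β q f x) ≤
      Real.exp (K * (β / 2 * (Fintype.card ι * ε ^ 2) - a)) *
        Real.exp (K * pressure K β q f u r t) := by
    rw [exp_pressure hK, Finset.mul_sum]
    refine Finset.sum_le_sum fun x _ => ?_
    by_cases hx : x ∈ A
    · rw [Set.indicator_of_mem hx, one_mul, ← Real.exp_add, ← mul_add]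
      refine Real.exp_le_exp.2 (mul_le_mul_of_nonneg_left ?_ hK.le)
      have h1 : ∑ k, (q x k - r k) ^ 2 ≤ Fintype.card ι * ε ^ 2 := by
        have : ∑ k, (q x k - r k) ^ 2 ≤ ∑ _k : ι, ε ^ 2 :=
          Finset.sum_le_sum fun k _ => sq_le_sq' (neg_le_of_abs_le (hq x hx k))
            (le_of_abs_le (hq x hx k))
        simpa using this
      have h2 := mul_le_mul_of_nonneg_left h1 (div_nonneg hβ zero_le_two)
      have h3 := hu x hx
      simp only [sub_sq, Finset.sum_add_distrib, Finset.sum_sub_distrib, mul_assoc,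
        ← Finset.mul_sum] at h2
      linarith
    · rw [Set.indicator_of_notMem hx, zero_mul]
      positivity
  have hpos : 0 < ∑ y, Real.exp (energy K β q f y) := (Real.exp_pos _).trans_le hZ
  calc gibbsMass (energy K β q f) A
      = (∑ x, A.indicator (fun _ => (1 : ℝ)) x * Real.exp (energy K β q f x)) /
        ∑ y, Real.exp (energy K β q f y) := by
        rw [gibbsMass, Finset.sum_div]
        simp only [mul_div_assoc]
    _ ≤ (Real.exp (K * (β / 2 * (Fintype.card ι * ε ^ 2) - a)) *
        Real.exp (K * pressure K β q f u r t)) / Real.exp (K * pressure K β q f u p 0) := by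
        gcongr
    _ = _ := by
        rw [← Real.exp_add, ← Real.exp_sub]
        congr 1
        ring

end

theorem exists_pos_forall_le {α : Type*} (F : Finset α) (φ : α → ℝ) (h : ∀ x ∈ F, 0 < φ x) :
    ∃ γ : ℝ, 0 < γ ∧ ∀ x ∈ F, γ ≤ φ x := by
  have h1 : ∀ᶠ γ in 𝓝[>] (0 : ℝ), ∀ x ∈ F, γ ≤ φ x :=
    (Finset.eventually_all F).2 fun x hx =>
      (tendsto_id.mono_left nhdsWithin_le_nhds).eventually_le_const (h x hx)
  obtain ⟨γ, hγ, hpos⟩ := (h1.and self_mem_nhdsWithin).exists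
  exact ⟨γ, hpos, hγ⟩

theorem exists_pos_mul_sq_le {c b : ℝ} (hb : 0 < b) : ∃ ε : ℝ, 0 < ε ∧ c * ε ^ 2 ≤ b := by
  have h1 : Tendsto (fun ε : ℝ => c * ε ^ 2) (𝓝[>] 0) (𝓝 (c * 0 ^ 2)) :=
    (Continuous.tendsto (by fun_prop) 0).mono_left nhdsWithin_le_nhds
  obtain ⟨ε, hε, hpos⟩ := ((h1.eventually_le_const (by simpa using hb)).and
    self_mem_nhdsWithin).exists
  exact ⟨ε, hpos, hε⟩

/-- If the pressures are close to a function with the unique maximizer `p`, then the order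
parameter concentrates at `p`. -/
theorem orderParameter_concentrates {ι : Type} [Fintype ι] {β : ℝ} (hβ : 0 ≤ β)
    (G : (ι → ℝ) → ℝ → ℝ) (p : ι → ℝ) (hp : ∀ r, r ≠ p → G r 0 < G p 0) {δ : ℝ} (hδ : 0 < δ) :
    ∃ (F : Finset ((ι → ℝ) × ℝ)) (η κ C : ℝ), 0 < η ∧ 0 < κ ∧
      ∀ (Ω : Type) [Fintype Ω] [Nonempty Ω] (K : ℝ) (q : Ω → ι → ℝ) (f u : Ω → ℝ), 0 < K →
        (∀ x k, |q x k| ≤ 1) →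
        (∀ z ∈ F, |pressure K β q f u z.1 z.2 - G z.1 z.2| ≤ η) →
        gibbsMass (energy K β q f) {x | ∃ k, δ < |q x k - p k|} ≤ C * Real.exp (-(κ * K)) := by
  classical
  -- The ball around r is so small that linearizing at r costs at most half of the gap `G p 0 - G r
  -- 0`; at p the radius is a dummy value.
  have hε : ∀ r : ι → ℝ, ∃ ε : ℝ, 0 < ε ∧
      (r ≠ p → β / 2 * Fintype.card ι * ε ^ 2 ≤ (G p 0 - G r 0) / 2) := by
    intro r
    by_cases hr : r = p
    · exact ⟨1, one_pos, fun h => absurd hr h⟩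
    · obtain ⟨ε, h1, h2⟩ := exists_pos_mul_sq_le (c := β / 2 * Fintype.card ι)
        (half_pos (sub_pos.2 (hp r hr)))
      exact ⟨ε, h1, fun _ => h2⟩
  choose ε hεpos hε using hε
  have hcomp : IsCompact (Metric.closedBall (0 : ι → ℝ) 1 \ Metric.ball p δ) :=
    (isCompact_closedBall _ _).diff Metric.isOpen_ball
  obtain ⟨F, hF, hcover⟩ := hcomp.elim_nhds_subcover (fun r => Metric.closedBall r (ε r))
    (fun r _ => Metric.closedBall_mem_nhds r (hεpos r))
  have hFp : ∀ r ∈ F, r ≠ p := fun r hr h => (hF r hr).2 (h ▸ Metric.mem_ball_self hδ)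
  obtain ⟨γ, hγ, hγF⟩ := exists_pos_forall_le F (fun r => G p 0 - G r 0)
    (fun r hr => sub_pos.2 (hp r (hFp r hr)))
  -- Of a gap at least γ, half pays for the linearization and 2 · γ/8 for the two pressure errors;
  -- the rate γ/4 is left.
  refine ⟨(insert p F).image fun r => (r, 0), γ / 8, γ / 4, F.card, by positivity, by positivity,
    ?_⟩
  intro Ω _ _ K q f u hK hq hclose
  have hcl : ∀ r ∈ insert p F, |pressure K β q f u r 0 - G r 0| ≤ γ / 8 := fun r hr =>
    hclose (r, 0) (Finset.mem_image_of_mem _ hr)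
  refine (gibbsMass_le_sum _ _ F (fun r => {x | ∀ k, |q x k - r k| ≤ ε r}) ?_).trans ?_
  · rintro x ⟨k, hk⟩
    have hx : q x ∈ Metric.closedBall (0 : ι → ℝ) 1 \ Metric.ball p δ := by
      refine ⟨?_, fun hmem => ?_⟩
      · rw [mem_closedBall_zero_iff, pi_norm_le_iff_of_nonneg zero_le_one]
        exact hq x
      · have := (dist_le_pi_dist (q x) p k).trans_lt hmem
        rw [Real.dist_eq] at this
        linarith
    obtain ⟨r, hr, hxr⟩ := Set.mem_iUnion₂.1 (hcover hx)
    refine ⟨r, hr, fun k => ?_⟩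
    rw [← Real.dist_eq]
    exact (dist_le_pi_dist (q x) r k).trans hxr
  · rw [← nsmul_eq_mul]
    refine Finset.sum_le_card_nsmul _ _ _ fun r hr => ?_
    refine (gibbsMass_energy_le hK hβ q f u p r (ε := ε r) (t := 0) (a := 0) _ (fun x hx => hx)
      (fun x _ => by simp)).trans (Real.exp_le_exp.2 ?_)
    have h1 := abs_le.1 (hcl r (Finset.mem_insert_of_mem hr))
    have h2 := abs_le.1 (hcl p (Finset.mem_insert_self _ _))
    have h3 := hε r (hFp r hr)
    have h4 := hγF r hr
    have : pressure K β q f u r 0 - pressure K β q f u p 0 +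
        β / 2 * (Fintype.card ι * ε r ^ 2) - 0 ≤ -(γ / 4) := by
      linarith [h1.2, h2.1]
    have := mul_le_mul_of_nonneg_left this hK.le
    linarith

/-- If moreover the tilted limiting pressure at `p` has derivative `c`, then the observable `u`
concentrates at `c`. -/
theorem observable_concentrates {ι : Type} [Fintype ι] {β : ℝ} (hβ : 0 ≤ β)
    (G : (ι → ℝ) → ℝ → ℝ) (p : ι → ℝ) (hp : ∀ r, r ≠ p → G r 0 < G p 0) {c : ℝ}
    (hc : HasDerivAt (G p) c 0) {δ : ℝ} (hδ : 0 < δ) :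
    ∃ (F : Finset ((ι → ℝ) × ℝ)) (η κ C : ℝ), 0 < η ∧ 0 < κ ∧
      ∀ (Ω : Type) [Fintype Ω] [Nonempty Ω] (K : ℝ) (q : Ω → ι → ℝ) (f u : Ω → ℝ), 0 < K →
        (∀ x k, |q x k| ≤ 1) →
        (∀ z ∈ F, |pressure K β q f u z.1 z.2 - G z.1 z.2| ≤ η) →
        gibbsMass (energy K β q f) {x | δ < |u x - c|} ≤ C * Real.exp (-(κ * K)) := by
  classical
  -- A single t is chosen for which both slopes, at t and at -t, are within δ/2 of c: one tilt for
  -- each tail.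
  have hder : ∀ᶠ t in 𝓝 (0 : ℝ), |G p t - G p 0 - t * c| ≤ δ / 2 * |t| := by
    have := (hasDerivAt_iff_isLittleO.1 hc).def (half_pos hδ)
    simpa using this
  have hder' : ∀ᶠ t in 𝓝[>] (0 : ℝ), |G p (-t) - G p 0 - (-t) * c| ≤ δ / 2 * |(-t)| := by
    have h0 : Tendsto (fun t : ℝ => -t) (𝓝[>] 0) (𝓝 0) := by
      simpa using (continuous_neg.tendsto (0 : ℝ)).mono_left
        (nhdsWithin_le_nhds (s := Set.Ioi 0))
    exact h0.eventually hder
  obtain ⟨t, ⟨ht1, ht2⟩, ht⟩ := (((hder.filter_mono nhdsWithin_le_nhds).and hder').and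
    self_mem_nhdsWithin).exists
  replace ht : 0 < t := ht
  rw [abs_of_pos ht] at ht1
  rw [abs_neg, abs_of_pos ht] at ht2
  obtain ⟨ε, hε, hεt⟩ := exists_pos_mul_sq_le (c := β / 2 * Fintype.card ι)
    (show 0 < t * δ / 4 by positivity)
  obtain ⟨F, η, κ, C, hη, hκ, hF⟩ := orderParameter_concentrates hβ G p hp hε
  -- From the Chebyshev gain tδ subtract tδ/2 (slope), tδ/4 (linearization) and 2 · tδ/16 (pressure
  -- errors): tδ/8 remains. The prefactor counts the event that q is far from p and the two tails of
  -- u.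
  refine ⟨F ∪ {(p, 0), (p, t), (p, -t)}, min η (t * δ / 16), min κ (t * δ / 8), |C| + 2,
    by positivity, by positivity, ?_⟩
  intro Ω _ _ K q f u hK hq hclose
  have hA := hF Ω K q f u hK hq fun z hz =>
    (hclose z (Finset.mem_union_left _ hz)).trans (min_le_left _ _)
  have h0 := abs_le.1 ((hclose (p, 0) (by simp)).trans (min_le_right _ _))
  have h1 := abs_le.1 ((hclose (p, t) (by simp)).trans (min_le_right _ _))
  have h2 := abs_le.1 ((hclose (p, -t) (by simp)).trans (min_le_right _ _))
  have e1 := abs_le.1 ht1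
  have e2 := abs_le.1 ht2
  dsimp only at h0 h1 h2
  have hB := gibbsMass_energy_le hK hβ q f u p p (ε := ε) (t := t) (a := t * (c + δ))
    {x | (∀ k, |q x k - p k| ≤ ε) ∧ c + δ ≤ u x} (fun x hx => hx.1)
    (fun x hx => mul_le_mul_of_nonneg_left hx.2 ht.le)
  have hC := gibbsMass_energy_le hK hβ q f u p p (ε := ε) (t := -t) (a := -t * (c - δ))
    {x | (∀ k, |q x k - p k| ≤ ε) ∧ u x ≤ c - δ} (fun x hx => hx.1)
    (fun x hx => mul_le_mul_of_nonpos_left hx.2 (by linarith))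
  have key : ∀ y : ℝ, y ≤ -(t * δ / 8) →
      Real.exp (K * y) ≤ Real.exp (-(min κ (t * δ / 8) * K)) := fun y hy => by
    refine Real.exp_le_exp.2 ?_
    have := mul_le_mul_of_nonneg_left hy hK.le
    have := mul_le_mul_of_nonneg_right (min_le_right κ (t * δ / 8)) hK.le
    linarith
  have hB' := hB.trans (key _ (by linarith [h0.1, h1.2, e1.2]))
  have hC' := hC.trans (key _ (by linarith [h0.1, h2.2, e2.2]))
  have hA' : C * Real.exp (-(κ * K)) ≤ |C| * Real.exp (-(min κ (t * δ / 8) * K)) := by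
    refine mul_le_mul (le_abs_self C) (Real.exp_le_exp.2 ?_) (Real.exp_pos _).le (abs_nonneg C)
    have := mul_le_mul_of_nonneg_right (min_le_left κ (t * δ / 8)) hK.le
    linarith
  refine (gibbsMass_le_add _ _ {x | ∃ k, ε < |q x k - p k|}
    {x | (∀ k, |q x k - p k| ≤ ε) ∧ c + δ ≤ u x}
    {x | (∀ k, |q x k - p k| ≤ ε) ∧ u x ≤ c - δ} ?_).trans (by linarith)
  intro x hx
  by_cases hg : ∀ k, |q x k - p k| ≤ ε
  · rcases lt_abs.1 (show δ < |u x - c| from hx) with h | h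
    · exact Or.inl (Or.inr ⟨hg, by linarith⟩)
    · exact Or.inr ⟨hg, by linarith⟩
  · push Not at hg
    exact Or.inl (Or.inl hg)

/-! ### The Curie-Weiss variational problem -/

theorem hasDerivAt_log_cosh (x : ℝ) :
    HasDerivAt (fun y => Real.log (Real.cosh y)) (Real.tanh x) x := by
  rw [Real.tanh_eq_sinh_div_cosh]
  exact (Real.hasDerivAt_cosh x).log (Real.cosh_pos x).ne'

theorem hasDerivAt_tanh (x : ℝ) : HasDerivAt Real.tanh (1 / Real.cosh x ^ 2) x := by
  have h := (Real.hasDerivAt_sinh x).div (Real.hasDerivAt_cosh x) (Real.cosh_pos x).ne'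
  have h1 : Real.cosh x * Real.cosh x - Real.sinh x * Real.sinh x = 1 := by
    linarith [Real.cosh_sq x]
  rw [h1] at h
  exact h.congr_of_eventuallyEq (Eventually.of_forall Real.tanh_eq_sinh_div_cosh)

/-- The derivative 1/cosh² is below 1 except at 0, so an interval containing 0 in its interior is
split there. -/
theorem tanh_sub_lt {x y : ℝ} (h : x < y) : Real.tanh y - Real.tanh x < y - x := by
  have key : ∀ {a b : ℝ}, a < b → (0 ≤ a ∨ b ≤ 0) → Real.tanh b - Real.tanh a < b - a := by
    intro a b hab h0
    obtain ⟨c, ⟨hc1, hc2⟩, hc⟩ := exists_hasDerivAt_eq_slope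
      (fun t => Real.tanh t) (fun t => 1 / Real.cosh t ^ 2) hab
      (fun t _ => (hasDerivAt_tanh t).continuousAt.continuousWithinAt)
      (fun t _ => hasDerivAt_tanh t)
    have hc0 : c ≠ 0 := by
      rintro rfl
      rcases h0 with h0 | h0 <;> linarith
    have hlt : 1 / Real.cosh c ^ 2 < 1 := by
      have h1 := Real.one_lt_cosh.2 hc0
      rw [div_lt_one (by positivity)]
      exact one_lt_pow₀ h1 two_ne_zero
    rwa [hc, div_lt_one (sub_pos.2 hab)] at hlt
  rcases le_or_gt 0 x with hx | hx
  · exact key h (Or.inl hx)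
  rcases le_or_gt y 0 with hy | hy
  · exact key h (Or.inr hy)
  have h1 := key hx (Or.inr le_rfl)
  have h2 := key hy (Or.inl le_rfl)
  linarith

theorem strictConcaveOn_tanh : StrictConcaveOn ℝ (Set.Ici 0) Real.tanh := by
  refine StrictAntiOn.strictConcaveOn_of_deriv (convex_Ici 0)
    (fun t _ => (hasDerivAt_tanh t).continuousAt.continuousWithinAt) ?_
  rw [interior_Ici, funext fun x => (hasDerivAt_tanh x).deriv]
  intro x hx y hy hxy
  have : Real.cosh x < Real.cosh y := by
    rw [Real.cosh_lt_cosh, abs_of_pos hx, abs_of_pos hy]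
    exact hxy
  exact one_div_lt_one_div_of_lt (pow_pos (Real.cosh_pos x) 2)
    (pow_lt_pow_left₀ this (Real.cosh_pos x).le two_ne_zero)

theorem tanh_pos {x : ℝ} (hx : 0 < x) : 0 < Real.tanh x := by
  rw [Real.tanh_eq_sinh_div_cosh]
  exact div_pos (Real.sinh_pos_iff.2 hx) (Real.cosh_pos x)

theorem log_cosh_le_abs (x : ℝ) : Real.log (Real.cosh x) ≤ |x| := by
  rw [← Real.cosh_abs, Real.log_le_iff_le_exp (Real.cosh_pos _), Real.cosh_eq]
  have : Real.exp (-|x|) ≤ Real.exp |x| := Real.exp_le_exp.2 (by linarith [abs_nonneg x])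
  linarith

theorem hasDerivAt_cwFun (β h x : ℝ) :
    HasDerivAt (cwFun β h) (β * (Real.tanh (β * x + h) - x)) x := by
  have h1 : HasDerivAt (fun y : ℝ => β * y + h) β x := by
    simpa using ((hasDerivAt_id x).const_mul β).add_const h
  have h2 := (((hasDerivAt_log_cosh (β * x + h)).comp x h1).const_add (Real.log 2)).sub
    ((((hasDerivAt_id x).pow 2).const_mul β).div_const 2)
  refine h2.congr_deriv ?_
  simp
  ring

theorem exists_cwFun_maximizer {β : ℝ} (hβ : 0 < β) (h : ℝ) :
    ∃ x, ∀ y, cwFun β h y ≤ cwFun β h x := by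
  have hcont : Continuous (cwFun β h) :=
    continuous_iff_continuousAt.2 fun x => (hasDerivAt_cwFun β h x).continuousAt
  refine hcont.exists_forall_ge' (x₀ := 0) ?_
  -- Beyond this threshold the linear bound β|x| + |h| on log cosh is dominated by βx²/2.
  have hb : ∀ x, (2 * (1 + |h| / β) ) < |x| → cwFun β h x ≤ cwFun β h 0 := by
    intro x hx
    have h1 := log_cosh_le_abs (β * x + h)
    have h2 : |β * x + h| ≤ β * |x| + |h| := by
      rw [← abs_of_pos hβ, ← abs_mul, abs_of_pos hβ]
      exact abs_add_le _ _
    have h3 : 0 ≤ Real.log (Real.cosh (β * 0 + h)) := Real.log_nonneg (Real.one_le_cosh _)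
    have h4 : |h| = β * (|h| / β) := by field_simp
    have h5 : 0 ≤ |h| / β := by positivity
    have h6 : x ^ 2 = |x| ^ 2 := (sq_abs x).symm
    unfold cwFun
    set a := |h| / β
    have h7 : β * (|x| + a) ≤ β * (|x| ^ 2 / 2) := by
      refine mul_le_mul_of_nonneg_left ?_ hβ.le
      nlinarith
    rw [h6]
    simp only [ne_eq, OfNat.ofNat_ne_zero, not_false_eq_true, zero_pow, mul_zero, zero_div] at *
    nlinarith
  have := (tendsto_norm_cocompact_atTop (E := ℝ)).eventually_gt_atTop (2 * (1 + |h| / β))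
  filter_upwards [this] with x hx using hb x hx

theorem eq_tanh_of_cwFun_maximizer {β : ℝ} (hβ : 0 < β) {h x : ℝ}
    (hx : ∀ y, cwFun β h y ≤ cwFun β h x) : Real.tanh (β * x + h) = x := by
  have h1 : IsLocalMax (cwFun β h) x := Eventually.of_forall hx
  have h2 := h1.hasDerivAt_eq_zero (hasDerivAt_cwFun β h x)
  have := (mul_eq_zero.1 h2).resolve_left hβ.ne'
  linarith

theorem cwFun_neg (β h x : ℝ) : cwFun β (-h) (-x) = cwFun β h x := by
  unfold cwFun
  rw [← Real.cosh_neg]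
  ring_nf

/-- Reflecting a negative x to -x would increase the log cosh term; strict positivity then follows
from the fixed point equation. -/
theorem cwFun_maximizer_pos {β : ℝ} (hβ : 0 < β) {h x : ℝ} (hh : 0 < h)
    (hx : ∀ y, cwFun β h y ≤ cwFun β h x) : 0 < x := by
  have h0 : 0 ≤ x := by
    by_contra! hneg
    have h1 : Real.cosh (β * x + h) < Real.cosh (β * (-x) + h) := by
      have : 0 < β * (-x) := mul_pos hβ (by linarith)
      rw [Real.cosh_lt_cosh, abs_of_pos (show 0 < β * (-x) + h by linarith), abs_lt]
      constructor <;> linarith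
    have h2 := Real.log_lt_log (Real.cosh_pos _) h1
    have h3 := hx (-x)
    unfold cwFun at h3
    rw [neg_sq] at h3
    linarith
  rw [← eq_tanh_of_cwFun_maximizer hβ hx]
  exact tanh_pos (by positivity)

/-- For positive fixed points x < y, the point βx + h divides the segment from h to βy + h in ratio
x/y. Strict concavity of tanh gives x > (1 - x/y) tanh h + x, impossible as tanh h > 0. -/
theorem cwFun_maximizer_unique_of_pos {β : ℝ} (hβ : 0 < β) {h x y : ℝ} (hh : 0 < h)
    (hx : ∀ z, cwFun β h z ≤ cwFun β h x) (hy : ∀ z, cwFun β h z ≤ cwFun β h y) : x = y := by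
  wlog hxy : x < y generalizing x y
  · rcases lt_trichotomy x y with h1 | h1 | h1
    · exact this hx hy h1
    · exact h1
    · exact (this hy hx h1).symm
  exfalso
  have hx0 := cwFun_maximizer_pos hβ hh hx
  have hy0 := cwFun_maximizer_pos hβ hh hy
  have ex := eq_tanh_of_cwFun_maximizer hβ hx
  have ey := eq_tanh_of_cwFun_maximizer hβ hy
  have ha : 0 < 1 - x / y := sub_pos.2 ((div_lt_one hy0).2 hxy)
  have hb : 0 < x / y := by positivity
  have hc := strictConcaveOn_tanh.2 (x := h) hh.le (y := β * y + h)
    (show (0 : ℝ) ≤ β * y + h by positivity) (by nlinarith) ha hb (by ring)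
  simp only [smul_eq_mul] at hc
  have e : (1 - x / y) * h + x / y * (β * y + h) = β * x + h := by
    field_simp
    ring
  rw [e, ex, ey, div_mul_cancel₀ _ hy0.ne'] at hc
  have := mul_pos ha (tanh_pos hh)
  linarith

/-- For β ≤ 1, two fixed points would contradict the strict contraction `tanh_sub_lt`; h < 0 reduces
to h > 0 by x ↦ -x. -/
theorem cwFun_maximizer_unique {β h : ℝ} (hβ : 0 < β) (hreg : β ≤ 1 ∨ h ≠ 0) {x y : ℝ}
    (hx : ∀ z, cwFun β h z ≤ cwFun β h x) (hy : ∀ z, cwFun β h z ≤ cwFun β h y) : x = y := by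
  rcases hreg with h1 | hne
  · wlog hxy : x < y generalizing x y
    · rcases lt_trichotomy x y with h2 | h2 | h2
      · exact this hx hy h2
      · exact h2
      · exact (this hy hx h2).symm
    exfalso
    have ex := eq_tanh_of_cwFun_maximizer hβ hx
    have ey := eq_tanh_of_cwFun_maximizer hβ hy
    have := tanh_sub_lt (show β * x + h < β * y + h by nlinarith)
    nlinarith
  · rcases lt_or_gt_of_ne hne with hh | hh
    · have key : ∀ {w : ℝ}, (∀ z, cwFun β h z ≤ cwFun β h w) →
          ∀ z, cwFun β (-h) z ≤ cwFun β (-h) (-w) := fun {w} hw z => by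
        have := hw (-z)
        rwa [← cwFun_neg, ← cwFun_neg β h w, neg_neg] at this
      exact neg_injective (cwFun_maximizer_unique_of_pos hβ (neg_pos.2 hh) (key hx) (key hy))
    · exact cwFun_maximizer_unique_of_pos hβ hh hx hy

theorem cwFun_le_m0 {β : ℝ} (hβ : 0 < β) (h y : ℝ) : cwFun β h y ≤ cwFun β h (m0 β h) :=
  Classical.epsilon_spec (exists_cwFun_maximizer hβ h) y

theorem cwFun_lt_m0 {β h : ℝ} (hβ : 0 < β) (hreg : β ≤ 1 ∨ h ≠ 0) {x : ℝ} (hx : x ≠ m0 β h) :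
    cwFun β h x < cwFun β h (m0 β h) := by
  refine lt_of_le_of_ne (cwFun_le_m0 hβ h x) fun heq => hx ?_
  exact cwFun_maximizer_unique hβ hreg (fun z => heq ▸ cwFun_le_m0 hβ h z) (cwFun_le_m0 hβ h)

theorem tanh_m0 {β : ℝ} (hβ : 0 < β) (h : ℝ) : Real.tanh (β * m0 β h + h) = m0 β h :=
  eq_tanh_of_cwFun_maximizer hβ (cwFun_le_m0 hβ h)

/-! ### Overlaps, and the two laws as Gibbs measures with quadratic energy -/

theorem vec_sq {N : ℕ} (x : Spins N) (i : Fin N) : vec x i ^ 2 = 1 := by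
  unfold vec
  rcases Int.units_eq_one_or (x i) with h | h <;> simp [h]

theorem abs_vec {N : ℕ} (x : Spins N) (i : Fin N) : |vec x i| = 1 := by
  unfold vec
  rcases Int.units_eq_one_or (x i) with h | h <;> simp [h]

@[simp]
theorem vec_one {N : ℕ} : vec (1 : Spins N) = 1 := by
  ext i
  simp [vec]

theorem vec_mul {N : ℕ} (x y : Spins N) : vec (x * y) = vec x * vec y := by
  ext i
  simp [vec]

theorem abs_overlap_le {N : ℕ} (x y : Spins N) : |overlap (vec x) (vec y)| ≤ 1 := by
  unfold overlap
  rw [abs_div, Nat.abs_cast]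
  refine div_le_one_of_le₀ ((Finset.abs_sum_le_sum_abs _ _).trans ?_) (Nat.cast_nonneg N)
  simp [abs_mul, abs_vec]

theorem natCast_mul_overlap {N : ℕ} (hN : 0 < N) (x y : Fin N → ℝ) :
    N * overlap x y = ∑ i, x i * y i := by
  unfold overlap
  field_simp

theorem sum_sq_eq_add_two_mul_sum_Ioi {N : ℕ} (z : Fin N → ℝ) :
    (∑ i, z i) ^ 2 = ∑ i, z i ^ 2 + 2 * ∑ i, ∑ j ∈ Finset.Ioi i, z i * z j := by
  have h1 : ∑ i, ∑ j ∈ Finset.Iio i, z i * z j = ∑ i, ∑ j ∈ Finset.Ioi i, z i * z j := by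
    rw [Finset.sum_comm' (t' := Finset.univ) (s' := fun i => Finset.Ioi i) (by simp)]
    exact Finset.sum_congr rfl fun i _ => Finset.sum_congr rfl fun j _ => mul_comm _ _
  have h2 : ∀ i, ∑ j, z i * z j = z i ^ 2 + ∑ j ∈ Finset.Iio i, z i * z j
      + ∑ j ∈ Finset.Ioi i, z i * z j := by
    intro i
    have hu : (Finset.univ : Finset (Fin N)) = insert i (Finset.Iio i ∪ Finset.Ioi i) := by
      ext j
      rcases lt_trichotomy j i with h | h | h <;> simp [h]
    have hd : Disjoint (Finset.Iio i) (Finset.Ioi i) :=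
      Finset.disjoint_left.2 fun j hj hj' =>
        absurd (Finset.mem_Iio.1 hj) (not_lt_of_gt (Finset.mem_Ioi.1 hj'))
    rw [hu, Finset.sum_insert (by simp), Finset.sum_union hd]
    ring
  rw [sq, Finset.sum_mul_sum, Finset.sum_congr rfl fun i _ => h2 i]
  simp only [Finset.sum_add_distrib]
  rw [h1]
  ring

theorem pairSum_vec {N : ℕ} (hN : 0 < N) (x y : Spins N) :
    pairSum (vec x) (vec y) = (N ^ 2 * overlap (vec x) (vec y) ^ 2 - N) / 2 := by
  have h := sum_sq_eq_add_two_mul_sum_Ioi fun i => vec x i * vec y i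
  simp only [mul_pow, vec_sq, mul_one, Finset.sum_const, Finset.card_univ, Fintype.card_fin,
    nsmul_eq_mul] at h
  rw [← natCast_mul_overlap hN] at h
  unfold pairSum
  have h2 : ∀ i j, vec x i * vec x j * vec y i * vec y j =
      vec x i * vec y i * (vec x j * vec y j) := fun i j => by ring
  simp only [h2]
  linarith

/-- The overlaps of the examples with the uniform configuration. -/
noncomputable def exampleOverlap {N M : ℕ} (S : Fin M → Spins N) (μ : Fin M) : ℝ :=
  overlap (vec (S μ)) (vec 1)

/-- The overlaps of the examples with a student pattern. -/
noncomputable def studentOverlap {N M : ℕ} (S : Fin M → Spins N) (ξ : Spins N) (μ : Fin M) : ℝ :=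
  overlap (vec (S μ)) (vec ξ)

/-- The fraction of sites at which the examples take the values `a`. -/
noncomputable def columnFreq {N M : ℕ} (a : Spins M) (S : Fin M → Spins N) : ℝ :=
  (∑ i, if (fun μ => S μ i) = a then 1 else 0) / N

theorem exampleWeight_one {N : ℕ} (hN : 0 < N) (β h : ℝ) (s : Spins N) :
    exampleWeight β h 1 s = Real.exp (-(β / 2)) *
      Real.exp (N * (β / 2 * overlap (vec s) (vec 1) ^ 2 + h * overlap (vec s) (vec 1))) := by
  have hN' : (N : ℝ) ≠ 0 := by positivity
  unfold exampleWeight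
  have hc : overlap (vec 1) (vec s) = overlap (vec s) (vec 1) := by simp [overlap, mul_comm]
  rw [pairSum_vec hN, ← natCast_mul_overlap hN, hc, ← Real.exp_add]
  congr 1
  field_simp
  ring

/-- The M independent examples form one system with a vector order parameter; the diagonal terms of
the squared overlaps are constant and cancel on normalization. -/
theorem examplesLaw_one {N M : ℕ} (hN : 0 < N) (β h : ℝ) (S : Fin M → Spins N) :
    examplesLaw β h 1 S =
      Real.exp (energy N β exampleOverlap (fun S => h * ∑ μ, exampleOverlap S μ) S) /
      ∑ S' : Fin M → Spins N,
        Real.exp (energy N β exampleOverlap (fun S => h * ∑ μ, exampleOverlap S μ) S') := by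
  have hw : ∀ S : Fin M → Spins N,
      Real.exp (energy N β exampleOverlap (fun S => h * ∑ μ, exampleOverlap S μ) S) =
      ∏ μ, Real.exp (N * (β / 2 * overlap (vec (S μ)) (vec 1) ^ 2
        + h * overlap (vec (S μ)) (vec 1))) := by
    intro S
    rw [← Real.exp_sum, energy]
    congr 1
    simp only [Finset.mul_sum, ← Finset.sum_add_distrib, exampleOverlap]
  simp only [hw]
  rw [examplesLaw, ← Fintype.prod_sum fun (_ : Fin M) (s : Spins N) =>
    Real.exp (N * (β / 2 * overlap (vec s) (vec 1) ^ 2 + h * overlap (vec s) (vec 1))),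
    ← Finset.prod_div_distrib]
  refine Finset.prod_congr rfl fun μ _ => ?_
  simp only [exampleWeight_one hN, ← Finset.mul_sum]
  exact mul_div_mul_left _ _ (Real.exp_pos _).ne'

theorem studentLaw_one {N M : ℕ} (hN : 0 < N) (β lam : ℝ) (S : Fin M → Spins N) (ξ : Spins N) :
    studentLaw β lam 1 S ξ =
      Real.exp (energy N β (studentOverlap S) (fun ξ => lam * overlap (vec 1) (vec ξ)) ξ) /
      ∑ ξ' : Spins N,
        Real.exp (energy N β (studentOverlap S) (fun ξ => lam * overlap (vec 1) (vec ξ)) ξ') := by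
  have hN' : (N : ℝ) ≠ 0 := by positivity
  have hw : ∀ ξ : Spins N, studentWeight β lam 1 S ξ = Real.exp (-(M * β / 2)) *
      Real.exp (energy N β (studentOverlap S) (fun ξ => lam * overlap (vec 1) (vec ξ)) ξ) := by
    intro ξ
    rw [studentWeight, energy, ← Real.exp_add]
    congr 1
    simp only [pairSum_vec hN, ← natCast_mul_overlap hN, studentOverlap, ← Finset.sum_div,
      Finset.sum_sub_distrib, ← Finset.mul_sum, Finset.sum_const, Finset.card_univ,
      Fintype.card_fin, nsmul_eq_mul]
    field_simp
    ring
  rw [studentLaw]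
  simp only [hw, ← Finset.mul_sum]
  exact mul_div_mul_left _ _ (Real.exp_pos _).ne'

/-! ### Tangent pressures of the student and of the examples -/

theorem sum_units_exp (c : ℝ) :
    ∑ a : ℤˣ, Real.exp (c * ((a : ℤ) : ℝ)) = 2 * Real.cosh c := by
  rw [Real.cosh_eq]
  simp
  ring

theorem sum_exp_sum_mul_vec {n : ℕ} (c : Fin n → ℝ) :
    ∑ x : Spins n, Real.exp (∑ i, c i * vec x i) = ∏ i, (2 * Real.cosh (c i)) := by
  simp only [Real.exp_sum, ← sum_units_exp]
  rw [Fintype.prod_sum]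
  rfl

theorem log_prod_two_mul_cosh {n : ℕ} (c : Fin n → ℝ) :
    Real.log (∏ i, (2 * Real.cosh (c i))) = n * Real.log 2 + ∑ i, Real.log (Real.cosh (c i)) := by
  rw [Real.log_prod fun i _ => by positivity]
  simp only [Real.log_mul two_ne_zero (Real.cosh_pos _).ne', Finset.sum_add_distrib]
  simp

/-- The tangent energy is a sum over sites, and site i sees the examples only through its column;
grouping sites by column gives `g` with empirical frequencies, the tilt merely shifting `lam`. -/
theorem pressure_student {N M : ℕ} (hN : 0 < N) (β lam : ℝ) (S : Fin M → Spins N)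
    (r : Fin M → ℝ) (t : ℝ) :
    pressure N β (studentOverlap S) (fun ξ => lam * overlap (vec 1) (vec ξ))
      (fun ξ => overlap (vec 1) (vec ξ)) r t =
    Real.log 2 - β * (∑ μ, r μ ^ 2) / 2 + ∑ a : Spins M, columnFreq a S *
      Real.log (Real.cosh (β * (∑ μ, vec a μ * r μ) + (lam + t))) := by
  have hN' : (N : ℝ) ≠ 0 := by positivity
  have h1 : ∀ ξ : Spins N, N * (β * ∑ μ, studentOverlap S ξ μ * r μ +
      lam * overlap (vec 1) (vec ξ) + t * overlap (vec 1) (vec ξ)) =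
      ∑ i, (β * (∑ μ, vec (S μ) i * r μ) + (lam + t)) * vec ξ i := by
    intro ξ
    have e1 : ∑ μ, (N * studentOverlap S ξ μ) * r μ =
        ∑ i, (∑ μ, vec (S μ) i * r μ) * vec ξ i := by
      simp only [studentOverlap, natCast_mul_overlap hN, Finset.sum_mul]
      rw [Finset.sum_comm]
      exact Finset.sum_congr rfl fun i _ => Finset.sum_congr rfl fun μ _ => by ring
    have e2 : N * overlap (vec 1) (vec ξ) = ∑ i, vec ξ i := by
      rw [natCast_mul_overlap hN]
      simp
    simp only [add_mul, Finset.sum_add_distrib, mul_assoc, ← Finset.mul_sum] at e1 ⊢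
    rw [← e1, ← e2]
    ring
  have h2 : ∀ i, Real.log (Real.cosh (β * (∑ μ, vec (S μ) i * r μ) + (lam + t))) =
      ∑ a : Spins M, (if (fun μ => S μ i) = a then 1 else 0) *
        Real.log (Real.cosh (β * (∑ μ, vec a μ * r μ) + (lam + t))) := by
    intro i
    simp only [ite_mul, one_mul, zero_mul, Finset.sum_ite_eq, Finset.mem_univ, if_true]
    rfl
  have h3 : ∑ i, Real.log (Real.cosh (β * (∑ μ, vec (S μ) i * r μ) + (lam + t))) =
      N * ∑ a : Spins M, columnFreq a S *
        Real.log (Real.cosh (β * (∑ μ, vec a μ * r μ) + (lam + t))) := by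
    simp only [h2]
    rw [Finset.sum_comm, Finset.mul_sum]
    refine Finset.sum_congr rfl fun a _ => ?_
    rw [← Finset.sum_mul, columnFreq]
    field_simp
  unfold pressure
  simp only [h1]
  rw [sum_exp_sum_mul_vec, log_prod_two_mul_cosh, h3]
  field_simp
  ring

/-- The pressure of the examples tilted by the frequency of the column `a`. -/
noncomputable def columnPressure {M : ℕ} (β h : ℝ) (a : Spins M) (r : Fin M → ℝ) (t : ℝ) : ℝ :=
  Real.log (∑ b : Spins M,
    Real.exp (∑ μ, (β * r μ + h) * vec b μ + t * (if b = a then 1 else 0)))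
    - β / 2 * ∑ μ, r μ ^ 2

/-- Transposing the M × N array of spins makes the columns independent, so the identity is exact for
every positive N. -/
theorem pressure_examples {N M : ℕ} (hN : 0 < N) (β h : ℝ) (a : Spins M) (r : Fin M → ℝ)
    (t : ℝ) :
    pressure N β (exampleOverlap (N := N)) (fun S => h * ∑ μ, exampleOverlap S μ)
      (columnFreq a) r t = columnPressure β h a r t := by
  have hN' : (N : ℝ) ≠ 0 := by positivity
  have h1 : ∀ S : Fin M → Spins N, N * (β * ∑ μ, exampleOverlap S μ * r μ +
      h * ∑ μ, exampleOverlap S μ + t * columnFreq a S) =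
      ∑ i, (∑ μ, (β * r μ + h) * vec (fun ν => S ν i) μ +
        t * (if (fun μ => S μ i) = a then 1 else 0)) := by
    intro S
    have e1 : ∀ μ, N * exampleOverlap S μ = ∑ i, vec (S μ) i := fun μ => by
      rw [exampleOverlap, natCast_mul_overlap hN]
      simp
    have e2 : N * columnFreq a S = ∑ i, if (fun μ => S μ i) = a then 1 else 0 := by
      unfold columnFreq
      field_simp
    rw [Finset.sum_add_distrib, ← Finset.mul_sum, ← e2, Finset.sum_comm]
    have e3 : ∀ μ, ∑ i, (β * r μ + h) * vec (fun ν => S ν i) μ =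
        N * (β * (exampleOverlap S μ * r μ) + h * exampleOverlap S μ) := fun μ => by
      rw [← Finset.mul_sum]
      have : ∑ i, vec (fun ν => S ν i) μ = N * exampleOverlap S μ := (e1 μ).symm
      rw [this]
      ring
    simp only [e3, ← Finset.mul_sum, Finset.sum_add_distrib]
    ring
  unfold pressure columnPressure
  simp only [h1, Real.exp_sum (Finset.univ : Finset (Fin N))]
  have h2 : ∑ S : Fin M → Spins N, ∏ i, Real.exp (∑ μ, (β * r μ + h) * vec (fun ν => S ν i) μ +
        t * (if (fun μ => S μ i) = a then 1 else 0)) =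
      (∑ b : Spins M,
        Real.exp (∑ μ, (β * r μ + h) * vec b μ + t * (if b = a then 1 else 0))) ^ N := by
    refine (Fintype.sum_equiv (Equiv.piComm fun (_ : Fin M) (_ : Fin N) => ℤˣ) _
      (fun T : Fin N → Spins M => ∏ i, Real.exp (∑ μ, (β * r μ + h) * vec (T i) μ +
        t * (if T i = a then 1 else 0))) (fun S => rfl)).trans ?_
    rw [← Fintype.prod_sum fun (_ : Fin N) (b : Spins M) =>
      Real.exp (∑ μ, (β * r μ + h) * vec b μ + t * (if b = a then 1 else 0))]
    simp
  rw [h2, Real.log_pow, mul_div_cancel_left₀ _ hN']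

theorem columnPressure_zero {M : ℕ} (β h : ℝ) (a : Spins M) (r : Fin M → ℝ) :
    columnPressure β h a r 0 = ∑ μ, cwFun β h (r μ) := by
  unfold columnPressure cwFun
  simp only [zero_mul, add_zero]
  rw [sum_exp_sum_mul_vec, log_prod_two_mul_cosh]
  simp only [Finset.sum_add_distrib, Finset.sum_sub_distrib, Finset.sum_const, Finset.card_univ,
    Fintype.card_fin, nsmul_eq_mul, ← Finset.sum_div, ← Finset.mul_sum]
  ring

theorem columnPressure_lt {M : ℕ} {β h : ℝ} (hβ : 0 < β) (hreg : β ≤ 1 ∨ h ≠ 0) (a : Spins M)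
    (r : Fin M → ℝ) (hr : r ≠ fun _ => m0 β h) :
    columnPressure β h a r 0 < columnPressure β h a (fun _ => m0 β h) 0 := by
  rw [columnPressure_zero, columnPressure_zero]
  obtain ⟨μ, hμ⟩ := Function.ne_iff.1 hr
  exact Finset.sum_lt_sum (fun ν _ => cwFun_le_m0 hβ h (r ν))
    ⟨μ, Finset.mem_univ _, cwFun_lt_m0 hβ hreg hμ⟩

/-- The derivative is the weight of `a` under independent spins in the field c = β m₀ + h, and
e^{±c} / (2 cosh c) = (1 ± tanh c)/2 with tanh c = m₀. -/
theorem hasDerivAt_columnPressure {M : ℕ} {β : ℝ} (hβ : 0 < β) (h : ℝ) (a : Spins M) :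
    HasDerivAt (columnPressure β h a fun _ => m0 β h) (∏ μ, (1 + m0 β h * vec a μ) / 2) 0 := by
  set c := β * m0 β h + h with hc
  have hterm : ∀ b : Spins M, HasDerivAt (fun t : ℝ =>
      Real.exp (∑ μ, c * vec b μ + t * (if b = a then 1 else 0)))
      (if b = a then Real.exp (∑ μ, c * vec b μ) else 0) 0 := by
    intro b
    have h1 : HasDerivAt (fun t : ℝ => ∑ μ, c * vec b μ + t * (if b = a then 1 else 0))
        (if b = a then 1 else 0) 0 := by
      simpa using ((hasDerivAt_id (0 : ℝ)).mul_const (if b = a then (1 : ℝ) else 0)).const_add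
        (∑ μ, c * vec b μ)
    have h2 := h1.exp
    refine h2.congr_deriv ?_
    split_ifs <;> simp
  have hsum := HasDerivAt.fun_sum (u := Finset.univ) fun b (_ : b ∈ Finset.univ) => hterm b
  have hZ : ∑ b : Spins M, Real.exp (∑ μ, c * vec b μ + 0 * (if b = a then 1 else 0)) =
      ∏ _μ : Fin M, (2 * Real.cosh c) := by
    simp only [zero_mul, add_zero]
    exact sum_exp_sum_mul_vec _
  have hpos : 0 < ∏ _μ : Fin M, (2 * Real.cosh c) :=
    Finset.prod_pos fun _ _ => by positivity
  have hlog := (hsum.log (by rw [hZ]; exact hpos.ne')).sub_const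
    (β / 2 * ∑ _μ : Fin M, m0 β h ^ 2)
  refine hlog.congr_deriv ?_
  rw [hZ, Finset.sum_ite_eq' Finset.univ a, if_pos (Finset.mem_univ a), Real.exp_sum,
    ← Finset.prod_div_distrib]
  refine Finset.prod_congr rfl fun μ _ => ?_
  have ht : m0 β h = Real.sinh c / Real.cosh c := by
    rw [← Real.tanh_eq_sinh_div_cosh, hc, tanh_m0 hβ]
  have hcosh := Real.cosh_pos c
  rw [ht]
  unfold vec
  rcases Int.units_eq_one_or (a μ) with h | h
  · simp only [h, Units.val_one, Int.cast_one, mul_one]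
    field_simp
    rw [Real.cosh_add_sinh]
  · simp only [h, Units.val_neg, Units.val_one, Int.cast_neg, Int.cast_one, mul_neg, mul_one]
    field_simp
    rw [← sub_eq_add_neg, Real.cosh_sub_sinh]

/-! ### The gauge-fixed expectation -/

theorem examplesLaw_nonneg {N M : ℕ} (β h : ℝ) (σ : Spins N) (S : Fin M → Spins N) :
    0 ≤ examplesLaw β h σ S :=
  Finset.prod_nonneg fun _ _ => div_nonneg (Real.exp_pos _).le
    (Finset.sum_nonneg fun _ _ => (Real.exp_pos _).le)

theorem studentLaw_nonneg {N M : ℕ} (β lam : ℝ) (σ : Spins N) (S : Fin M → Spins N)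
    (ξ : Spins N) : 0 ≤ studentLaw β lam σ S ξ :=
  div_nonneg (Real.exp_pos _).le (Finset.sum_nonneg fun _ _ => (Real.exp_pos _).le)

theorem sum_studentLaw {N M : ℕ} (β lam : ℝ) (σ : Spins N) (S : Fin M → Spins N) :
    ∑ ξ, studentLaw β lam σ S ξ = 1 := by
  unfold studentLaw
  rw [← Finset.sum_div]
  exact div_self (Finset.sum_pos (fun _ _ => Real.exp_pos _) Finset.univ_nonempty).ne'

theorem sum_examplesLaw {N M : ℕ} (β h : ℝ) (σ : Spins N) :
    ∑ S : Fin M → Spins N, examplesLaw β h σ S = 1 := by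
  unfold examplesLaw
  rw [← Fintype.prod_sum fun (_ : Fin M) (s : Spins N) =>
    exampleWeight β h σ s / ∑ s : Spins N, exampleWeight β h σ s]
  refine Finset.prod_eq_one fun μ _ => ?_
  rw [← Finset.sum_div]
  exact div_self (Finset.sum_pos (fun _ _ => Real.exp_pos _) Finset.univ_nonempty).ne'

theorem gaugedBracket_mono {N M : ℕ} (β lam h : ℝ) {f g : Config N M → ℝ}
    (hfg : ∀ S ξ, f ⟨1, S, ξ⟩ ≤ g ⟨1, S, ξ⟩) :
    gaugedBracket β lam h f ≤ gaugedBracket β lam h g :=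
  Finset.sum_le_sum fun S _ => Finset.sum_le_sum fun ξ _ =>
    mul_le_mul_of_nonneg_right (mul_le_mul_of_nonneg_right (hfg S ξ)
      (studentLaw_nonneg _ _ _ _ _)) (examplesLaw_nonneg _ _ _ _)

theorem gaugedBracket_examples {N M : ℕ} (β lam h : ℝ) (φ : (Fin M → Spins N) → ℝ) :
    gaugedBracket β lam h (fun ω : Config N M => φ ω.ex) = ∑ S, φ S * examplesLaw β h 1 S := by
  unfold gaugedBracket bracketGiven
  refine Finset.sum_congr rfl fun S _ => ?_
  simp only [← Finset.sum_mul, ← Finset.mul_sum, sum_studentLaw, mul_one]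

theorem gaugedBracket_const {N M : ℕ} (β lam h c : ℝ) :
    gaugedBracket β lam h (fun _ : Config N M => c) = c := by
  rw [gaugedBracket_examples β lam h fun _ => c, ← Finset.mul_sum, sum_examplesLaw, mul_one]

theorem gaugedBracket_add {N M : ℕ} (β lam h : ℝ) (f g : Config N M → ℝ) :
    gaugedBracket β lam h (fun ω => f ω + g ω) =
      gaugedBracket β lam h f + gaugedBracket β lam h g := by
  simp only [gaugedBracket, bracketGiven, add_mul, Finset.sum_add_distrib]

theorem gaugedBracket_const_mul {N M : ℕ} (β lam h c : ℝ) (f : Config N M → ℝ) :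
    gaugedBracket β lam h (fun ω => c * f ω) = c * gaugedBracket β lam h f := by
  simp only [gaugedBracket, bracketGiven, mul_assoc, Finset.mul_sum]

theorem indicator_le_indicator_of_imp {α α' : Type*} {A : Set α} {B : Set α'} {x : α} {y : α'}
    (h : x ∈ A → y ∈ B) :
    A.indicator (fun _ => (1 : ℝ)) x ≤ B.indicator (fun _ => (1 : ℝ)) y := by
  by_cases hx : x ∈ A
  · rw [Set.indicator_of_mem hx, Set.indicator_of_mem (h hx)]
  · rw [Set.indicator_of_notMem hx]
    exact Set.indicator_nonneg (fun _ _ => zero_le_one) y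

theorem tendsto_gaugedBracket {M : ℕ} (β lam h : ℝ) (X : ∀ N : ℕ, Config N M → ℝ) (c : ℝ)
    (hX : ∀ N (ω : Config N M), |X N ω| ≤ 1)
    (hs : SelfAveragingAt (fun _ => gaugedBracket β lam h) X c) :
    Tendsto (fun N => gaugedBracket β lam h (X N)) atTop (𝓝 c) := by
  rw [Metric.tendsto_atTop']
  intro δ hδ
  have h1 := (hs (δ / 2) (half_pos hδ)).const_mul (1 + |c|)
  rw [mul_zero] at h1
  obtain ⟨n, hn⟩ := eventually_atTop.1 (h1.eventually_lt_const (half_pos hδ))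
  refine ⟨n, fun N hN => ?_⟩
  have hpt : ∀ ω : Config N M, |X N ω - c| ≤ δ / 2 +
      (1 + |c|) * Set.indicator {ω | δ / 2 < |X N ω - c|} (fun _ => 1) ω := by
    intro ω
    by_cases hω : ω ∈ {ω | δ / 2 < |X N ω - c|}
    · rw [Set.indicator_of_mem hω]
      linarith [abs_sub (X N ω) c, hX N ω]
    · rw [Set.indicator_of_notMem hω]
      linarith [not_lt.1 (show ¬δ / 2 < |X N ω - c| from hω)]
  have hup := gaugedBracket_mono β lam h (f := X N) (g := fun ω => c + (δ / 2 +
    (1 + |c|) * Set.indicator {ω | δ / 2 < |X N ω - c|} (fun _ => 1) ω))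
    fun S ξ => by linarith [(abs_le.1 (hpt ⟨1, S, ξ⟩)).2]
  have hlo := gaugedBracket_mono β lam h (f := fun _ => c) (g := fun ω => X N ω + (δ / 2 +
    (1 + |c|) * Set.indicator {ω | δ / 2 < |X N ω - c|} (fun _ => 1) ω))
    fun S ξ => by linarith [(abs_le.1 (hpt ⟨1, S, ξ⟩)).1]
  simp only [gaugedBracket_add, gaugedBracket_const, gaugedBracket_const_mul] at hup hlo
  have := hn N hN.le
  rw [Real.dist_eq, abs_lt]
  constructor <;> linarith

/-! ### Gauge invariance -/

/-- The gauge transformation that maps the signal `σ` to the uniform one. -/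
def gauge {N M : ℕ} (ω : Config N M) : Config N M :=
  ⟨1, fun μ => ω.signal * ω.ex μ, ω.signal * ω.student⟩

theorem vec_mul_self {N : ℕ} (x : Spins N) (i : Fin N) : vec x i * vec x i = 1 := by
  rw [← sq, vec_sq]

theorem exampleWeight_gauge {N : ℕ} (β h : ℝ) (σ s : Spins N) :
    exampleWeight β h 1 (σ * s) = exampleWeight β h σ s := by
  unfold exampleWeight pairSum
  simp only [vec_mul, vec_one, Pi.mul_apply, Pi.one_apply, one_mul]
  simp only [mul_assoc, mul_left_comm (vec s _)]

theorem examplesLaw_gauge {N M : ℕ} (β h : ℝ) (σ : Spins N) (S : Fin M → Spins N) :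
    examplesLaw β h 1 (fun μ => σ * S μ) = examplesLaw β h σ S := by
  unfold examplesLaw
  have : ∑ s : Spins N, exampleWeight β h 1 s = ∑ s : Spins N, exampleWeight β h σ s :=
    (Fintype.sum_equiv (Equiv.mulLeft σ) _ _ fun s => (exampleWeight_gauge β h σ s).symm).symm
  simp only [exampleWeight_gauge, this]

theorem studentWeight_gauge {N M : ℕ} (β lam : ℝ) (σ : Spins N) (S : Fin M → Spins N)
    (ξ : Spins N) :
    studentWeight β lam 1 (fun μ => σ * S μ) (σ * ξ) = studentWeight β lam σ S ξ := by
  have key : ∀ (x y : Spins N) i j, vec σ i * vec x i * (vec σ j * vec x j) *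
      (vec σ i * vec y i) * (vec σ j * vec y j) = vec x i * vec x j * vec y i * vec y j := by
    intro x y i j
    linear_combination (vec x i * vec x j * vec y i * vec y j) *
      (vec σ j * vec σ j * vec_mul_self σ i + vec_mul_self σ j)
  unfold studentWeight pairSum
  simp only [vec_mul, vec_one, Pi.mul_apply, Pi.one_apply, one_mul, key]

theorem studentLaw_gauge {N M : ℕ} (β lam : ℝ) (σ : Spins N) (S : Fin M → Spins N)
    (ξ : Spins N) :
    studentLaw β lam 1 (fun μ => σ * S μ) (σ * ξ) = studentLaw β lam σ S ξ := by
  unfold studentLaw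
  rw [studentWeight_gauge]
  congr 1
  exact (Fintype.sum_equiv (Equiv.mulLeft σ) _ _
    fun s => (studentWeight_gauge β lam σ S s).symm).symm

theorem bracket_eq_gaugedBracket {N M : ℕ} (β lam h : ℝ) (f : Config N M → ℝ)
    (hf : ∀ ω, f (gauge ω) = f ω) : bracket β lam h f = gaugedBracket β lam h f := by
  have key : ∀ σ : Spins N, bracketGiven β lam h σ f = gaugedBracket β lam h f := by
    intro σ
    unfold gaugedBracket bracketGiven
    refine Fintype.sum_equiv (Equiv.piCongrRight fun _ : Fin M => Equiv.mulLeft σ) _ _ fun S => ?_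
    refine Fintype.sum_equiv (Equiv.mulLeft σ) _ _ fun ξ => ?_
    have e1 : (Equiv.piCongrRight fun _ : Fin M => Equiv.mulLeft σ) S = fun μ => σ * S μ := rfl
    rw [e1, Equiv.coe_mulLeft, studentLaw_gauge, examplesLaw_gauge]
    rw [← hf ⟨σ, S, ξ⟩]
    rfl
  unfold bracket
  simp only [key]
  have hcard : Fintype.card (Spins N) = 2 ^ N := by simp
  rw [Finset.sum_const, Finset.card_univ, hcard, nsmul_eq_mul]
  push_cast
  field_simp

theorem overlap_gauge {N : ℕ} (σ x y : Spins N) :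
    overlap (vec (σ * x)) (vec (σ * y)) = overlap (vec x) (vec y) := by
  unfold overlap
  congr 1
  refine Finset.sum_congr rfl fun i _ => ?_
  simp only [vec_mul, Pi.mul_apply]
  linear_combination (vec x i * vec y i) * vec_mul_self σ i

theorem exampleSignal_gauge {N M : ℕ} (μ : Fin M) (ω : Config N M) :
    exampleSignal μ N (gauge ω) = exampleSignal μ N ω := by
  have h := overlap_gauge ω.signal (ω.ex μ) ω.signal
  have h1 : ω.signal * ω.signal = 1 := by
    ext i
    simp
  rw [h1] at h
  exact h

theorem exampleStudent_gauge {N M : ℕ} (μ : Fin M) (ω : Config N M) :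
    exampleStudent μ N (gauge ω) = exampleStudent μ N ω :=
  overlap_gauge ω.signal (ω.ex μ) ω.student

theorem signalStudent_gauge {N M : ℕ} (ω : Config N M) :
    signalStudent N (gauge ω) = signalStudent N ω := by
  have h := overlap_gauge ω.signal ω.signal ω.student
  have h1 : ω.signal * ω.signal = 1 := by
    ext i
    simp
  rw [h1] at h
  exact h

theorem selfAveragingAt_bracket {M : ℕ} {β lam h : ℝ} {X : ∀ N : ℕ, Config N M → ℝ} {c : ℝ}
    (hX : ∀ N (ω : Config N M), X N (gauge ω) = X N ω)
    (hs : SelfAveragingAt (fun _ => gaugedBracket β lam h) X c) :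
    SelfAveragingAt (fun _ => bracket β lam h) X c := by
  intro δ hδ
  refine (hs δ hδ).congr fun N => (bracket_eq_gaugedBracket β lam h _ fun ω => ?_).symm
  simp only [Set.indicator, Set.mem_ofPred_eq, hX]

/-! ### Concentration of the overlaps -/

theorem tendsto_const_mul_exp_neg {κ : ℝ} (hκ : 0 < κ) (C : ℝ) :
    Tendsto (fun N : ℕ => C * Real.exp (-(κ * N))) atTop (𝓝 0) := by
  have h1 : Tendsto (fun N : ℕ => -(κ * (N : ℝ))) atTop atBot :=
    tendsto_neg_atTop_atBot.comp (tendsto_natCast_atTop_atTop.const_mul_atTop hκ)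
  simpa using (Real.tendsto_exp_atBot.comp h1).const_mul C

theorem gaugedBracket_indicator_examples {N M : ℕ} (hN : 0 < N) (β lam h : ℝ)
    (A : Set (Fin M → Spins N)) :
    gaugedBracket β lam h (fun ω : Config N M => A.indicator (fun _ => 1) ω.ex) =
      gibbsMass (energy N β exampleOverlap (fun S => h * ∑ μ, exampleOverlap S μ)) A := by
  rw [gaugedBracket_examples, gibbsMass]
  simp only [examplesLaw_one hN]

theorem exampleSignal_selfAveraging {M : ℕ} {β h : ℝ} (hβ : 0 < β) (lam : ℝ)
    (hreg : β ≤ 1 ∨ h ≠ 0) (μ : Fin M) :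
    SelfAveragingAt (fun _ => gaugedBracket β lam h) (exampleSignal μ) (m0 β h) := by
  intro δ hδ
  -- The column `1` is an arbitrary choice: the untilted pressure does not involve it.
  obtain ⟨F, η, κ, C, hη, hκ, hF⟩ := orderParameter_concentrates hβ.le
    (columnPressure β h (1 : Spins M)) (fun _ => m0 β h) (columnPressure_lt hβ hreg 1) hδ
  refine squeeze_zero' (Eventually.of_forall fun N => ?_) ?_ (tendsto_const_mul_exp_neg hκ C)
  · rw [← gaugedBracket_const (N := N) (M := M) β lam h 0]
    exact gaugedBracket_mono β lam h fun S ξ => Set.indicator_nonneg (fun _ _ => zero_le_one) _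
  · filter_upwards [eventually_gt_atTop 0] with N hN
    refine le_trans ?_ (hF (Fin M → Spins N) N exampleOverlap
      (fun S => h * ∑ μ, exampleOverlap S μ) (columnFreq 1) (by exact_mod_cast hN)
      (fun S ν => abs_overlap_le _ _) fun z _ => by
        rw [pressure_examples hN, sub_self, abs_zero]
        exact hη.le)
    rw [← gaugedBracket_indicator_examples hN β lam h]
    refine gaugedBracket_mono β lam h fun S ξ => ?_
    exact indicator_le_indicator_of_imp fun hω => ⟨μ, hω⟩

theorem columnFreq_concentrates {M : ℕ} {β h : ℝ} (hβ : 0 < β) (lam : ℝ)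
    (hreg : β ≤ 1 ∨ h ≠ 0) (a : Spins M) {δ : ℝ} (hδ : 0 < δ) :
    Tendsto (fun N => gaugedBracket β lam h (fun ω : Config N M =>
      Set.indicator {S | δ < |columnFreq a S - ∏ μ, (1 + m0 β h * vec a μ) / 2|}
        (fun _ => 1) ω.ex)) atTop (𝓝 0) := by
  obtain ⟨F, η, κ, C, hη, hκ, hF⟩ := observable_concentrates hβ.le
    (columnPressure β h a) (fun _ => m0 β h) (columnPressure_lt hβ hreg a)
    (hasDerivAt_columnPressure hβ h a) hδ
  refine squeeze_zero' (Eventually.of_forall fun N => ?_) ?_ (tendsto_const_mul_exp_neg hκ C)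
  · rw [← gaugedBracket_const (N := N) (M := M) β lam h 0]
    exact gaugedBracket_mono β lam h fun S ξ => Set.indicator_nonneg (fun _ _ => zero_le_one) _
  · filter_upwards [eventually_gt_atTop 0] with N hN
    rw [gaugedBracket_indicator_examples hN β lam h]
    exact hF (Fin M → Spins N) N exampleOverlap
      (fun S => h * ∑ μ, exampleOverlap S μ) (columnFreq a) (by exact_mod_cast hN)
      (fun S ν => abs_overlap_le _ _) fun z _ => by
        rw [pressure_examples hN, sub_self, abs_zero]
        exact hη.le

/-- If the student's Gibbs measure gives a family of events exponentially small probability as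
soon as finitely many linearized pressures are close to their limits, then the events have
vanishing probability under the joint law. -/
theorem tendsto_gaugedBracket_student {M : ℕ} {β h : ℝ} (hβ : 0 < β) (lam : ℝ)
    (hreg : β ≤ 1 ∨ h ≠ 0) (A : ∀ N : ℕ, (Fin M → Spins N) → Set (Spins N))
    (F : Finset ((Fin M → ℝ) × ℝ)) {η κ C : ℝ} (hη : 0 < η) (hκ : 0 < κ)
    (hA : ∀ (N : ℕ) (S : Fin M → Spins N), 0 < N →
      (∀ z ∈ F, |pressure N β (studentOverlap S) (fun ξ => lam * overlap (vec 1) (vec ξ))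
        (fun ξ => overlap (vec 1) (vec ξ)) z.1 z.2 - g β (lam + z.2) h z.1| ≤ η) →
      gibbsMass (energy N β (studentOverlap S) (fun ξ => lam * overlap (vec 1) (vec ξ)))
        (A N S) ≤ C * Real.exp (-(κ * N))) :
    Tendsto (fun N => gaugedBracket β lam h (fun ω : Config N M =>
      (A N ω.ex).indicator (fun _ => 1) ω.student)) atTop (𝓝 0) := by
  set w : Spins M → ℝ := fun a => ∏ μ, (1 + m0 β h * vec a μ) / 2 with hw
  set ℓ : (Fin M → ℝ) × ℝ → Spins M → ℝ := fun z a =>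
    Real.log (Real.cosh (β * (∑ μ, vec a μ * z.1 μ) + (lam + z.2))) with hℓ
  -- Frequencies off by at most δ move each of the finitely many pressures by at most δ ∑ |ℓ| ≤ η.
  obtain ⟨δ, hδ, hδF⟩ : ∃ δ : ℝ, 0 < δ ∧ ∀ z ∈ F, δ * ∑ a, |ℓ z a| ≤ η := by
    obtain ⟨δ, hδ, h1⟩ := exists_pos_forall_le F (fun z => η / (1 + ∑ a, |ℓ z a|))
      fun z _ => by positivity
    refine ⟨δ, hδ, fun z hz => ?_⟩
    have h2 : 0 ≤ ∑ a, |ℓ z a| := Finset.sum_nonneg fun _ _ => abs_nonneg _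
    have h3 := (le_div_iff₀ (by positivity)).1 (h1 z hz)
    nlinarith
  have hlim : Tendsto (fun N : ℕ => (∑ a, gaugedBracket β lam h (fun ω : Config N M =>
      Set.indicator {S | δ < |columnFreq a S - w a|} (fun _ => 1) ω.ex)) +
      |C| * Real.exp (-(κ * N))) atTop (𝓝 0) := by
    have := (tendsto_finsetSum Finset.univ fun (a : Spins M) _ =>
      columnFreq_concentrates hβ lam hreg a hδ).add (tendsto_const_mul_exp_neg hκ |C|)
    rw [Finset.sum_const_zero, add_zero] at this
    exact this
  refine squeeze_zero' (Eventually.of_forall fun N => ?_) ?_ hlim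
  · rw [← gaugedBracket_const (N := N) (M := M) β lam h 0]
    exact gaugedBracket_mono β lam h fun S ξ => Set.indicator_nonneg (fun _ _ => zero_le_one) _
  filter_upwards [eventually_gt_atTop 0] with N hN
  have hmass : ∀ S : Fin M → Spins N,
      ∑ ξ, (A N S).indicator (fun _ => (1 : ℝ)) ξ * studentLaw β lam 1 S ξ ≤
        (∑ a, Set.indicator {S | δ < |columnFreq a S - w a|} (fun _ => (1 : ℝ)) S) +
          |C| * Real.exp (-(κ * N)) := by
    intro S
    have hexp : 0 ≤ |C| * Real.exp (-(κ * N)) := by positivity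
    have hind : ∀ a ∈ Finset.univ,
        0 ≤ Set.indicator {S | δ < |columnFreq a S - w a|} (fun _ => (1 : ℝ)) S := fun a _ =>
      Set.indicator_nonneg (fun _ _ => zero_le_one) _
    -- If some frequency is atypical, its indicator already dominates the trivial bound 1; otherwise
    -- the pressures are close to `g` and `hA` applies.
    by_cases hS : ∃ a, δ < |columnFreq a S - w a|
    · obtain ⟨a, ha⟩ := hS
      have h1 : ∑ ξ, (A N S).indicator (fun _ => (1 : ℝ)) ξ * studentLaw β lam 1 S ξ ≤ 1 := by
        refine (Finset.sum_le_sum fun ξ _ => mul_le_of_le_one_left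
          (studentLaw_nonneg β lam 1 S ξ) ?_).trans_eq (sum_studentLaw β lam 1 S)
        exact Set.indicator_le_self' (fun _ _ => zero_le_one) ξ
      have h2 := Finset.single_le_sum hind (Finset.mem_univ a)
      rw [Set.indicator_of_mem (show S ∈ {S | δ < |columnFreq a S - w a|} from ha)] at h2
      linarith
    · push Not at hS
      have h1 := hA N S hN fun z hz => by
        rw [pressure_student hN, g, iidAvg, add_sub_add_left_eq_sub, ← Finset.sum_sub_distrib]
        refine (Finset.abs_sum_le_sum_abs _ _).trans (le_trans ?_ (hδF z hz))
        rw [Finset.mul_sum]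
        refine Finset.sum_le_sum fun a _ => ?_
        rw [mul_comm (Real.log _), ← sub_mul, abs_mul]
        exact mul_le_mul_of_nonneg_right (hS a) (abs_nonneg _)
      rw [gibbsMass] at h1
      simp only [← studentLaw_one hN] at h1
      have h2 := Finset.sum_nonneg hind
      have h3 := mul_le_mul_of_nonneg_right (le_abs_self C) (Real.exp_pos (-(κ * N))).le
      linarith
  calc gaugedBracket β lam h (fun ω : Config N M => (A N ω.ex).indicator (fun _ => 1) ω.student)
      = ∑ S : Fin M → Spins N, (∑ ξ, (A N S).indicator (fun _ => (1 : ℝ)) ξ *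
          studentLaw β lam 1 S ξ) * examplesLaw β h 1 S := by
        simp only [gaugedBracket, bracketGiven, Finset.sum_mul]
    _ ≤ ∑ S : Fin M → Spins N,
        ((∑ a, Set.indicator {S | δ < |columnFreq a S - w a|} (fun _ => (1 : ℝ)) S) +
          |C| * Real.exp (-(κ * N))) * examplesLaw β h 1 S :=
        Finset.sum_le_sum fun S _ =>
          mul_le_mul_of_nonneg_right (hmass S) (examplesLaw_nonneg _ _ _ _)
    _ = _ := by
        simp only [gaugedBracket_examples β lam h, add_mul, Finset.sum_add_distrib,
          ← Finset.mul_sum, sum_examplesLaw, mul_one, Finset.sum_mul]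
        rw [Finset.sum_comm]

theorem exampleStudent_selfAveraging {M : ℕ} {β h lam : ℝ} (hβ : 0 < β)
    (hreg : β ≤ 1 ∨ h ≠ 0) {p : Fin M → ℝ} (hp : ∀ q, q ≠ p → g β lam h q < g β lam h p)
    (μ : Fin M) :
    SelfAveragingAt (fun _ => gaugedBracket β lam h) (exampleStudent μ) (p μ) := by
  intro δ hδ
  obtain ⟨F, η, κ, C, hη, hκ, hF⟩ := orderParameter_concentrates hβ.le
    (fun r t => g β (lam + t) h r) p (by simpa using hp) hδ
  have h1 := tendsto_gaugedBracket_student hβ lam hreg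
    (fun N S => {ξ | ∃ k, δ < |studentOverlap S ξ k - p k|}) F hη hκ fun N S hN hcl =>
      hF (Spins N) N (studentOverlap S) _ _ (by exact_mod_cast hN)
        (fun ξ ν => abs_overlap_le _ _) hcl
  refine squeeze_zero (fun N => ?_) (fun N => ?_) h1
  · rw [← gaugedBracket_const (N := N) (M := M) β lam h 0]
    exact gaugedBracket_mono β lam h fun S ξ => Set.indicator_nonneg (fun _ _ => zero_le_one) _
  · refine gaugedBracket_mono β lam h fun S ξ => ?_
    exact indicator_le_indicator_of_imp fun hω => ⟨μ, hω⟩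

theorem hasDerivAt_g {M : ℕ} (β lam h : ℝ) (p : Fin M → ℝ) :
    HasDerivAt (fun t => g β (lam + t) h p)
      (iidAvg (m0 β h) fun s => Real.tanh (β * (∑ μ, s μ * p μ) + lam)) 0 := by
  unfold g iidAvg
  refine (HasDerivAt.fun_sum fun a _ => ?_).const_add _
  refine HasDerivAt.mul_const ?_ _
  have h1 : HasDerivAt (fun t : ℝ => β * (∑ μ, vec a μ * p μ) + (lam + t)) 1 0 :=
    ((hasDerivAt_id (0 : ℝ)).const_add lam).const_add _
  have h2 := hasDerivAt_log_cosh (β * (∑ μ, vec a μ * p μ) + (lam + 0))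
  simpa [Function.comp_def] using h2.comp (0 : ℝ) h1

theorem signalStudent_selfAveraging {M : ℕ} {β h lam : ℝ} (hβ : 0 < β)
    (hreg : β ≤ 1 ∨ h ≠ 0) {p : Fin M → ℝ} (hp : ∀ q, q ≠ p → g β lam h q < g β lam h p) :
    SelfAveragingAt (M := M) (fun _ => gaugedBracket β lam h) signalStudent
      (iidAvg (m0 β h) fun s => Real.tanh (β * (∑ μ, s μ * p μ) + lam)) := by
  intro δ hδ
  obtain ⟨F, η, κ, C, hη, hκ, hF⟩ := observable_concentrates hβ.le
    (fun r t => g β (lam + t) h r) p (by simpa using hp) (hasDerivAt_g β lam h p) hδ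
  exact tendsto_gaugedBracket_student hβ lam hreg (fun N _ => {ξ | δ < |overlap (vec 1) (vec ξ) -
      iidAvg (m0 β h) fun s => Real.tanh (β * (∑ μ, s μ * p μ) + lam)|}) F hη hκ
    fun N S hN hcl => hF (Spins N) N (studentOverlap S) _ _ (by exact_mod_cast hN)
      (fun ξ ν => abs_overlap_le _ _) hcl

end MeanField

theorem mainTheorem2 (M : ℕ) (hM : 0 < M) (β lam h : ℝ) (hβ : 0 ≤ β) (hreg : β ≤ 1 ∨ h ≠ 0)
    (p : Fin M → ℝ) (hp : ∀ q : Fin M → ℝ, q ≠ p → g β lam h q < g β lam h p) :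
    -- `m₀(β, h)` is well defined
    (∀ x : ℝ, x ≠ m0 β h → cwFun β h x < cwFun β h (m0 β h)) ∧
    -- example-signal overlap
    (∀ μ : Fin M,
      Tendsto (fun N => bracket β lam h (exampleSignal μ N)) atTop (𝓝 (m0 β h)) ∧
      Tendsto (fun N => gaugedBracket (M := M) β lam h
        (fun ω : Config N M => overlap (vec (ω.ex μ)) 1)) atTop (𝓝 (m0 β h))) ∧
    -- example-student overlap
    (∀ μ : Fin M,
      Tendsto (fun N => bracket β lam h (exampleStudent μ N)) atTop (𝓝 (p μ)) ∧
      Tendsto (fun N => gaugedBracket β lam h (exampleStudent μ N)) atTop (𝓝 (p μ))) ∧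
    -- student-signal overlap
    (Tendsto (fun N => bracket β lam h (signalStudent (M := M) N)) atTop
        (𝓝 (iidAvg (m0 β h) fun s : Fin M → ℝ => Real.tanh (β * (∑ μ, s μ * p μ) + lam))) ∧
      Tendsto (fun N => gaugedBracket (M := M) β lam h
        (fun ω : Config N M => overlap 1 (vec ω.student))) atTop
        (𝓝 (iidAvg (m0 β h) fun s : Fin M → ℝ => Real.tanh (β * (∑ μ, s μ * p μ) + lam)))) ∧
    -- self-averaging, under both brackets
    (∀ E : ∀ N : ℕ, (Config N M → ℝ) → ℝ,
      (E = (fun _ => bracket β lam h) ∨ E = (fun _ => gaugedBracket β lam h)) →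
      (∀ μ : Fin M, SelfAveragingAt E (exampleSignal μ) (m0 β h)) ∧
      (∀ μ : Fin M, SelfAveragingAt E (exampleStudent μ) (p μ)) ∧
      SelfAveragingAt E signalStudent
        (iidAvg (m0 β h) fun s : Fin M → ℝ => Real.tanh (β * (∑ μ, s μ * p μ) + lam))) := by
  -- At β = 0 the function `g` does not depend on p, which for M ≥ 1 contradicts uniqueness of the
  -- maximizer.
  have hβ' : 0 < β := by
    refine lt_of_le_of_ne hβ fun h0 => ?_
    have hne : p + 1 ≠ p := fun h1 => by
      have := congrFun h1 ⟨0, hM⟩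
      simp at this
    have := hp _ hne
    simp [g, ← h0] at this
  have hES := MeanField.exampleSignal_selfAveraging (M := M) hβ' lam hreg
  have hEX := MeanField.exampleStudent_selfAveraging hβ' hreg hp
  have hSS := MeanField.signalStudent_selfAveraging hβ' hreg hp
  have hESlim := fun μ => MeanField.tendsto_gaugedBracket β lam h _ _
    (fun N ω => MeanField.abs_overlap_le _ _) (hES μ)
  have hEXlim := fun μ => MeanField.tendsto_gaugedBracket β lam h _ _
    (fun N ω => MeanField.abs_overlap_le _ _) (hEX μ)
  have hSSlim := MeanField.tendsto_gaugedBracket β lam h _ _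
    (fun N ω => MeanField.abs_overlap_le _ _) hSS
  refine ⟨fun x hx => MeanField.cwFun_lt_m0 hβ' hreg hx, fun μ => ⟨?_, ?_⟩, fun μ => ⟨?_, hEXlim μ⟩,
    ⟨?_, ?_⟩, ?_⟩
  · exact (hESlim μ).congr fun N => (MeanField.bracket_eq_gaugedBracket β lam h _
      fun ω => MeanField.exampleSignal_gauge μ ω).symm
  · refine (hESlim μ).congr fun N => ?_
    simp only [gaugedBracket, bracketGiven, MeanField.vec_one]
  · exact (hEXlim μ).congr fun N => (MeanField.bracket_eq_gaugedBracket β lam h _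
      fun ω => MeanField.exampleStudent_gauge μ ω).symm
  · exact hSSlim.congr fun N => (MeanField.bracket_eq_gaugedBracket β lam h _
      fun ω => MeanField.signalStudent_gauge ω).symm
  · refine hSSlim.congr fun N => ?_
    simp only [gaugedBracket, bracketGiven, MeanField.vec_one]
  · rintro E (rfl | rfl)
    · exact ⟨fun μ => MeanField.selfAveragingAt_bracket
          (fun N ω => MeanField.exampleSignal_gauge μ ω) (hES μ),
        fun μ => MeanField.selfAveragingAt_bracket
          (fun N ω => MeanField.exampleStudent_gauge μ ω) (hEX μ),
        MeanField.selfAveragingAt_bracket (fun N ω => MeanField.signalStudent_gauge ω) hSS⟩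
    · exact ⟨hES, hEX, hSS⟩
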